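/- Let $\mathbb{S}^4$ be the unit sphere of $\mathbb{R}^5$ with its surface measure. A spherical harmonic of degree $p$ on $\mathbb{S}^4$ is the restriction to $\mathbb{S}^4$ of a (complex-valued) harmonic homogeneous polynomial of degree $p$ on $\mathbb{R}^5$. Given a pole $e\in\mathbb{S}^4$, a function on $\mathbb{S}^4$ is called zonal if it depends only on the geodesic distance to $e$, and a normalized zonal spherical harmonic of degree $p$ (with pole $e$) is a zonal spherical harmonic $Z_p$ of degree $p$ with $\|Z_p\|_{L^2(\mathbb{S}^4)}=1$. There exists a constant $C>0$ such that for every pole $e\in\mathbb{S}^4$, all integers $p,q,l\ge 1$, and all normalized zonal spherical harmonics $Z_p, Z_q, Z_l$ with pole $e$, of degrees $p,q,l$ respectively, $$\|Z_p Z_q Z_l\|_{L^1(\mathbb{S}^4)}\le C\,\bigl(\min(p,q,l)\bigr)^{1/2}.$$ -/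

import Mathlib

open MeasureTheory Metric

noncomputable section

/-- The unit sphere `𝕊^d` of `ℝ^(d+1)`. -/
abbrev UnitSphere (d : ℕ) : Type :=
  sphere (0 : EuclideanSpace ℝ (Fin (d + 1))) 1

/-- The Riemannian volume (surface measure) of `𝕊^d`, not normalized. -/
def surfaceMeasure (d : ℕ) : Measure (UnitSphere d) :=
  (volume : Measure (EuclideanSpace ℝ (Fin (d + 1)))).toSphere

/-- The geodesic distance on `𝕊^d`: the angle, in `[0, π]`, between two unit vectors. -/
def geodesicDist {d : ℕ} (x y : UnitSphere d) : ℝ :=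
  InnerProductGeometry.angle (x : EuclideanSpace ℝ (Fin (d + 1))) y

/-- A function on `𝕊^d` is zonal with respect to the pole `e` if it depends only on the geodesic
distance to `e`. -/
def IsZonal {d : ℕ} (e : UnitSphere d) (F : UnitSphere d → ℂ) : Prop :=
  ∃ g : ℝ → ℂ, ∀ x, F x = g (geodesicDist e x)

/-- The Euclidean Laplacian of a polynomial in `d + 1` variables. -/
def polyLaplacian {d : ℕ} (P : MvPolynomial (Fin (d + 1)) ℂ) : MvPolynomial (Fin (d + 1)) ℂ :=
  ∑ i, MvPolynomial.pderiv i (MvPolynomial.pderiv i P)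

/-- A spherical harmonic of degree `p` on `𝕊^d`: the restriction to the sphere of a homogeneous
harmonic polynomial of degree `p` on `ℝ^(d+1)`, with complex coefficients. -/
def IsSphericalHarmonic {d : ℕ} (p : ℕ) (F : UnitSphere d → ℂ) : Prop :=
  ∃ P : MvPolynomial (Fin (d + 1)) ℂ, P.IsHomogeneous p ∧ polyLaplacian P = 0 ∧
    ∀ x : UnitSphere d,
      F x = MvPolynomial.eval (fun i => (((x : EuclideanSpace ℝ (Fin (d + 1))) i : ℝ) : ℂ)) P

/-- A zonal spherical harmonic of degree `p` with pole `e`, normalized in `L²(𝕊^d)`. -/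
structure IsNormalizedZonalHarmonic {d : ℕ} (e : UnitSphere d) (p : ℕ)
    (Z : UnitSphere d → ℂ) : Prop where
  harmonic : IsSphericalHarmonic p Z
  zonal : IsZonal e Z
  norm_eq_one : eLpNorm Z 2 (surfaceMeasure d) = 1

end

/-! ### Energy estimates for the meridian equation -/

section

open Set
open Real (sin cos)
open scoped Real

/-! Along a meridian a zonal harmonic is a profile `f` of the angle `t`, and the surface measure
becomes `sin t ^ 3 dt` up to the volume of the 3-sphere. Everything follows from two pointwise
bounds for a normalized profile of degree `p`, with constants independent of `p`: `|f| ≲ p^(3/2)`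
everywhere, and `sin^(3/2) |f| ≲ 1`.

Both come from the differential equation alone, without special functions. The Liouville transform
`u = sin^(3/2) f` solves `u'' + (N² - 3/(4 sin²)) u = 0`. Its energy is largest at the equator
(`ZonalODE.energy_le`), and a virial identity bounds that maximum by `N² ∫ u²`
(`ZonalODE.energy_le_integral`). So `u² ≲ ∫ u²` wherever the potential is positive with room to
spare, that is for `N sin t ≥ 9/10`. Closer to a pole, `|f|` is at most its polar value, which is
compared with a value at distance about `1/N` (`ZonalODE.sq_pole_le`).

For the product, let `p` be the smallest degree. The second bound for the other two factors absorbs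
the weight `sin^3`, leaving `∫ |f_p|`. The two bounds together give `|f_p| ≲ (1/N + t)^(-3/2)` on
the hemisphere of the pole, and likewise at the antipode, so this integral is `O(√p)`. -/

/-- `f` solves the equation satisfied by zonal spherical harmonics of `𝕊⁴` along a meridian, where
`N = p + 3/2`. -/
structure ZonalODE (N : ℝ) (f f' f'' : ℝ → ℝ) : Prop where
  deriv1 : ∀ t, HasDerivAt f (f' t) t
  deriv2 : ∀ t, HasDerivAt f' (f'' t) t
  eqn : ∀ t, sin t ^ 2 * f'' t + 3 * (sin t * cos t) * f' t
    + (N ^ 2 - 9 / 4) * sin t ^ 2 * f t = 0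

namespace ZonalODE

variable {N : ℝ} {f f' f'' : ℝ → ℝ}

/-- The energy of the Liouville transform `sin ^ (3/2) * f`. -/
noncomputable def energy (N : ℝ) (f f' : ℝ → ℝ) (t : ℝ) : ℝ :=
  sin t * (sin t * f' t + 3 / 2 * cos t * f t) ^ 2
    + (N ^ 2 * sin t ^ 3 - 3 / 4 * sin t) * f t ^ 2

theorem reflect (h : ZonalODE N f f' f'') :
    ZonalODE N (fun t => f (π - t)) (fun t => -f' (π - t)) (fun t => f'' (π - t)) where
  deriv1 t := by
    have := (h.deriv1 (π - t)).comp t ((hasDerivAt_id t).const_sub π)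
    simpa [Function.comp_def] using this
  deriv2 t := by
    exact ((h.deriv2 (π - t)).comp t ((hasDerivAt_id t).const_sub π)).neg.congr_deriv (by simp)
  eqn t := by
    have := h.eqn (π - t)
    rw [Real.sin_pi_sub, Real.cos_pi_sub] at this
    linear_combination this

theorem continuous (h : ZonalODE N f f' f'') : Continuous f :=
  continuous_iff_continuousAt.2 fun t => (h.deriv1 t).continuousAt

theorem continuous' (h : ZonalODE N f f' f'') : Continuous f' :=
  continuous_iff_continuousAt.2 fun t => (h.deriv2 t).continuousAt

/-- In terms of `u = sin^(3/2) f` the energy is `u'² + Q u²` with `u'' = -Q u` and `Q = N² - 3/(4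
sin²)`, so only `Q' u²` survives differentiation. Written through `f`, the identity has no
singularity at the poles. -/
theorem hasDerivAt_energy (h : ZonalODE N f f' f'') (t : ℝ) :
    HasDerivAt (energy N f f') (3 / 2 * cos t * f t ^ 2) t := by
  have hs := Real.hasDerivAt_sin t
  have hc := Real.hasDerivAt_cos t
  have h1 := h.deriv1 t
  have h2 := h.deriv2 t
  have hw := (hs.mul h2).add ((hc.const_mul (3 / 2)).mul h1)
  have := (hs.mul (hw.pow 2)).add
    ((((hs.pow 3).const_mul (N ^ 2)).sub (hs.const_mul (3 / 4))).mul (h1.pow 2))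
  refine (this.congr_deriv ?_)
  have e := h.eqn t
  have t1 := Real.sin_sq_add_cos_sq t
  simp only [Pi.mul_apply, Pi.add_apply, Pi.pow_apply, Pi.sub_apply]
  push_cast
  linear_combination (2 * (sin t * f' t + 3 / 2 * cos t * f t)) * e
    + (3 / 2 * sin t * f t * f' t + 9 / 4 * cos t * f t ^ 2) * t1

/-- This is `(u u')' = u'² - Q u²`. Since `u u'` vanishes at both poles, the kinetic and potential
parts have equal integrals over the meridian. -/
theorem hasDerivAt_virial (h : ZonalODE N f f' f'') (t : ℝ) :
    HasDerivAt (fun t => sin t ^ 2 * f t * (sin t * f' t + 3 / 2 * cos t * f t))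
      (sin t * (sin t * f' t + 3 / 2 * cos t * f t) ^ 2
        - (N ^ 2 * sin t ^ 3 - 3 / 4 * sin t) * f t ^ 2) t := by
  have hs := Real.hasDerivAt_sin t
  have hc := Real.hasDerivAt_cos t
  have h1 := h.deriv1 t
  have h2 := h.deriv2 t
  have hw := (hs.mul h2).add ((hc.const_mul (3 / 2)).mul h1)
  have := ((hs.pow 2).mul h1).mul hw
  refine (this.congr_deriv ?_)
  have e := h.eqn t
  have t1 := Real.sin_sq_add_cos_sq t
  simp only [Pi.mul_apply, Pi.add_apply, Pi.pow_apply]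
  push_cast
  linear_combination (f t * sin t) * e + (3 / 4 * sin t * f t ^ 2) * t1

theorem energy_le (h : ZonalODE N f f' f'') {t : ℝ} (ht : t ∈ Icc 0 π) :
    energy N f f' t ≤ energy N f f' (π / 2) := by
  have hd := h.hasDerivAt_energy
  have hcont : Continuous (energy N f f') :=
    continuous_iff_continuousAt.2 fun t => (hd t).continuousAt
  rcases le_total t (π / 2) with hle | hle
  · refine monotoneOn_of_hasDerivWithinAt_nonneg (convex_Icc 0 (π / 2)) hcont.continuousOn
      (fun x _ => (hd x).hasDerivWithinAt) (fun x hx => ?_) ⟨ht.1, hle⟩ ⟨by positivity, le_rfl⟩ hle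
    rw [interior_Icc] at hx
    have := Real.cos_nonneg_of_mem_Icc (x := x) ⟨by linarith [hx.1, Real.pi_pos], hx.2.le⟩
    positivity
  · refine antitoneOn_of_hasDerivWithinAt_nonpos (convex_Icc (π / 2) π) hcont.continuousOn
      (fun x _ => (hd x).hasDerivWithinAt) (fun x hx => ?_)
      ⟨le_rfl, by linarith [Real.pi_pos]⟩ ⟨hle, ht.2⟩ hle
    rw [interior_Icc] at hx
    have := Real.cos_nonpos_of_pi_div_two_le_of_le (x := x) hx.1.le (by linarith [hx.2, Real.pi_pos])
    have := mul_nonneg (neg_nonneg.2 this) (sq_nonneg (f x))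
    linarith

theorem potential_mul_sq_le (h : ZonalODE N f f' f'') {t : ℝ} (ht : t ∈ Icc 0 π) :
    sin t * (N ^ 2 * sin t ^ 2 - 3 / 4) * f t ^ 2 ≤ energy N f f' (π / 2) := by
  refine le_trans ?_ (h.energy_le ht)
  have := mul_nonneg (Real.sin_nonneg_of_mem_Icc ht)
    (sq_nonneg (sin t * f' t + 3 / 2 * cos t * f t))
  unfold energy
  linarith

theorem energy_nonneg (h : ZonalODE N f f' f'') : 0 ≤ energy N f f' (π / 2) := by
  have := h.energy_le (t := 0) ⟨le_rfl, Real.pi_pos.le⟩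
  simpa [energy] using this

/-- On this window the potential term controls `3 f²`, so the energy changes at rate at most half
its maximum and loses at most a quarter over a distance `1/2`. -/
theorem energy_ge_near_equator (h : ZonalODE N f f' f'') (hN : 5 / 2 ≤ N) {t : ℝ}
    (ht : t ∈ Icc (π / 2 - 1 / 2) (π / 2 + 1 / 2)) :
    3 / 4 * energy N f f' (π / 2) ≤ energy N f f' t := by
  set E := energy N f f' (π / 2) with hE
  have key : ∀ x ∈ Icc (π / 2 - 1 / 2) (π / 2 + 1 / 2), ‖3 / 2 * cos x * f x ^ 2‖ ≤ E / 2 := by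
    intro x hx
    have hs : 7 / 8 ≤ sin x := by
      have h1 := Real.one_sub_sq_div_two_le_cos (x := x - π / 2)
      rw [Real.cos_sub_pi_div_two] at h1
      have : (x - π / 2) ^ 2 ≤ 1 / 4 := by
        have := hx.1; have := hx.2; nlinarith
      linarith
    have h2 := h.potential_mul_sq_le (t := x)
      ⟨by linarith [hx.1, Real.pi_gt_three], by linarith [hx.2, Real.pi_gt_three]⟩
    have h3 : 3 ≤ sin x * (N ^ 2 * sin x ^ 2 - 3 / 4) := by
      have a : (25 : ℝ) / 4 ≤ N ^ 2 := by nlinarith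
      have b : (49 : ℝ) / 64 ≤ sin x ^ 2 := by nlinarith
      have c : (25 : ℝ) / 4 * (49 / 64) ≤ N ^ 2 * sin x ^ 2 := by gcongr
      nlinarith
    have h4 : 3 * f x ^ 2 ≤ E := (mul_le_mul_of_nonneg_right h3 (sq_nonneg _)).trans h2
    rw [norm_mul, norm_mul, Real.norm_eq_abs, Real.norm_eq_abs, Real.norm_eq_abs, abs_sq]
    have := Real.abs_cos_le_one x
    have : |cos x| * f x ^ 2 ≤ 1 * f x ^ 2 := by gcongr
    norm_num
    linarith
  have := (convex_Icc (π / 2 - 1 / 2) (π / 2 + 1 / 2)).norm_image_sub_le_of_norm_hasDerivWithin_le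
    (fun x _ => (h.hasDerivAt_energy x).hasDerivWithinAt) key
    (x := π / 2) (y := t) ⟨by linarith, by linarith⟩ ht
  have h5 : ‖t - π / 2‖ ≤ 1 / 2 := by
    rw [Real.norm_eq_abs, abs_le]; constructor <;> linarith [ht.1, ht.2]
  have h6 := h.energy_nonneg
  rw [← hE] at h6
  have : E / 2 * ‖t - π / 2‖ ≤ E / 2 * (1 / 2) := by gcongr
  have := (abs_le.1 ((Real.norm_eq_abs _).symm.le.trans
    (‹‖energy N f f' t - energy N f f' (π / 2)‖ ≤ _›))).1
  linarith

/-- The window around the equator has length 1, so `3/4` of the maximal energy is at most the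
integral of `u'² + N² u²`. The virial identity bounds that by `2 N² ∫ u²`. -/
theorem energy_le_integral (h : ZonalODE N f f' f'') (hN : 5 / 2 ≤ N) :
    energy N f f' (π / 2) ≤ 8 / 3 * N ^ 2 * ∫ t in (0)..π, sin t ^ 3 * f t ^ 2 := by
  have hf := h.continuous
  have hf' := h.continuous'
  set W : ℝ → ℝ := fun t => sin t * (sin t * f' t + 3 / 2 * cos t * f t) ^ 2 with hW
  have cW : Continuous W := by fun_prop
  have i1 : ∫ t in (0)..π, (W t - (N ^ 2 * sin t ^ 3 - 3 / 4 * sin t) * f t ^ 2) = 0 := by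
    rw [intervalIntegral.integral_eq_sub_of_hasDerivAt (fun t _ => h.hasDerivAt_virial t)
      (Continuous.intervalIntegrable (by fun_prop) _ _)]
    simp
  have i2 : ∫ t in (0)..π, W t ≤ N ^ 2 * ∫ t in (0)..π, sin t ^ 3 * f t ^ 2 := by
    rw [intervalIntegral.integral_sub (cW.intervalIntegrable _ _)
      (Continuous.intervalIntegrable (by fun_prop) _ _), sub_eq_zero] at i1
    rw [i1, ← intervalIntegral.integral_const_mul]
    refine intervalIntegral.integral_mono_on Real.pi_pos.le
      (Continuous.intervalIntegrable (by fun_prop) _ _)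
      (Continuous.intervalIntegrable (by fun_prop) _ _) fun t ht => ?_
    have := mul_nonneg (Real.sin_nonneg_of_mem_Icc ht) (sq_nonneg (f t))
    linarith
  have i3 : 3 / 4 * energy N f f' (π / 2) ≤
      ∫ t in (π / 2 - 1 / 2)..(π / 2 + 1 / 2), (W t + N ^ 2 * (sin t ^ 3 * f t ^ 2)) := by
    have : ∫ t in (π / 2 - 1 / 2)..(π / 2 + 1 / 2), 3 / 4 * energy N f f' (π / 2)
        = 3 / 4 * energy N f f' (π / 2) := by
      rw [intervalIntegral.integral_const]; norm_num
    rw [← this]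
    refine intervalIntegral.integral_mono_on (by linarith)
      (Continuous.intervalIntegrable (by fun_prop) _ _)
      (Continuous.intervalIntegrable (by fun_prop) _ _) fun t ht => ?_
    refine (h.energy_ge_near_equator hN ht).trans ?_
    have : 0 ≤ sin t := Real.sin_nonneg_of_nonneg_of_le_pi
      (by linarith [ht.1, Real.pi_gt_three]) (by linarith [ht.2, Real.pi_gt_three])
    have := mul_nonneg this (sq_nonneg (f t))
    simp only [energy, hW]
    linarith
  have i4 : ∫ t in (π / 2 - 1 / 2)..(π / 2 + 1 / 2), (W t + N ^ 2 * (sin t ^ 3 * f t ^ 2)) ≤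
      ∫ t in (0)..π, (W t + N ^ 2 * (sin t ^ 3 * f t ^ 2)) := by
    refine intervalIntegral.integral_mono_interval (by linarith [Real.pi_gt_three]) (by linarith)
      (by linarith [Real.pi_gt_three]) ?_ (Continuous.intervalIntegrable (by fun_prop) _ _)
    refine (ae_restrict_iff' measurableSet_Ioc).2 (ae_of_all _ fun t ht => ?_)
    have := Real.sin_nonneg_of_mem_Icc (Ioc_subset_Icc_self ht)
    simp only [hW, Pi.zero_apply]
    positivity
  have i5 := i3.trans i4
  rw [intervalIntegral.integral_add (cW.intervalIntegrable _ _)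
    (Continuous.intervalIntegrable (by fun_prop) _ _), intervalIntegral.integral_const_mul] at i5
  linarith

theorem sin_pow_mul_sq_le_of_le (h : ZonalODE N f f' f'') (hN : 5 / 2 ≤ N) {t : ℝ}
    (ht : t ∈ Icc 0 π) (hs : 9 / 10 ≤ N * sin t) :
    sin t ^ 3 * f t ^ 2 ≤ 37 * ∫ t in (0)..π, sin t ^ 3 * f t ^ 2 := by
  have h1 := (h.potential_mul_sq_le ht).trans (h.energy_le_integral hN)
  set A := ∫ t in (0)..π, sin t ^ 3 * f t ^ 2
  -- The threshold `9/10` works because its square exceeds `3/4`; the ratio is `25/27`, so a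
  -- fraction `2/27` of `N² sin²` survives.
  have h2 : 3 / 4 ≤ 25 / 27 * (N ^ 2 * sin t ^ 2) := by nlinarith
  have h3 : 0 ≤ sin t * f t ^ 2 := mul_nonneg (Real.sin_nonneg_of_mem_Icc ht) (sq_nonneg _)
  have h4 : N ^ 2 * (2 / 27 * (sin t ^ 3 * f t ^ 2)) ≤ N ^ 2 * (8 / 3 * A) := by
    nlinarith [mul_le_mul_of_nonneg_right h2 h3]
  have h5 := le_of_mul_le_mul_left h4 (by positivity)
  have : 0 ≤ A := by
    have := pow_nonneg (Real.sin_nonneg_of_mem_Icc ht) 3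
    have := mul_nonneg this (sq_nonneg (f t))
    linarith
  linarith

/-- The first-order term of the equation acts as friction up to the equator: `f'² + (N² - 9/4) f²`
decreases there, and at the pole it has no kinetic part. -/
theorem sq_le_sq_pole (h : ZonalODE N f f' f'') (hN : 5 / 2 ≤ N) (h0 : f' 0 = 0) {t : ℝ}
    (ht : t ∈ Icc 0 (π / 2)) : f t ^ 2 ≤ f 0 ^ 2 := by
  have hf := h.continuous
  have hf' := h.continuous'
  have hL : 0 < N ^ 2 - 9 / 4 := by nlinarith
  have hd : ∀ x, HasDerivAt (fun t => f' t ^ 2 + (N ^ 2 - 9 / 4) * f t ^ 2)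
      (2 * f' x * f'' x + (N ^ 2 - 9 / 4) * (2 * f x * f' x)) x := fun x => by
    refine (((h.deriv2 x).pow 2).add (((h.deriv1 x).pow 2).const_mul (N ^ 2 - 9 / 4))).congr_deriv ?_
    push_cast
    ring
  have := antitoneOn_of_hasDerivWithinAt_nonpos (convex_Icc 0 (π / 2))
    (f := fun t => f' t ^ 2 + (N ^ 2 - 9 / 4) * f t ^ 2) (by fun_prop)
    (fun x _ => (hd x).hasDerivWithinAt) (fun x hx => ?_) ⟨le_rfl, by positivity⟩ ht ht.1
  · simp only [h0] at this
    have h3 : (N ^ 2 - 9 / 4) * f t ^ 2 ≤ (N ^ 2 - 9 / 4) * f 0 ^ 2 := by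
      nlinarith [sq_nonneg (f' t)]
    exact le_of_mul_le_mul_left h3 hL
  · rw [interior_Icc] at hx
    have hs := Real.sin_pos_of_pos_of_lt_pi hx.1 (by linarith [hx.2, Real.pi_pos])
    have hc := Real.cos_nonneg_of_mem_Icc (x := x) ⟨by linarith [hx.1, Real.pi_pos], hx.2.le⟩
    have e := h.eqn x
    have : sin x ^ 2 * (2 * f' x * f'' x + (N ^ 2 - 9 / 4) * (2 * f x * f' x))
        = - (6 * (sin x * cos x) * f' x ^ 2) := by
      linear_combination (2 * f' x) * e
    by_contra! hcon
    have h1 := mul_pos (pow_pos hs 2) hcon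
    have h2 : 0 ≤ 6 * (sin x * cos x) * f' x ^ 2 := by positivity
    linarith

/-- In divergence form the equation reads `(sin³ f')' = -(N² - 9/4) sin³ f`. Bound the right side on
`[0, t]` using monotonicity of `sin` and the maximality of `|f 0|`, then divide by `sin³ t`. -/
theorem abs_deriv_le (h : ZonalODE N f f' f'') (hN : 5 / 2 ≤ N) (h0 : f' 0 = 0) {t : ℝ}
    (ht : t ∈ Icc 0 (π / 2)) : |f' t| ≤ (N ^ 2 - 9 / 4) * |f 0| * t := by
  have hL : 0 < N ^ 2 - 9 / 4 := by nlinarith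
  rcases ht.1.eq_or_lt with rfl | hpos
  · simp [h0]
  have hs := Real.sin_pos_of_pos_of_lt_pi hpos (by linarith [ht.2, Real.pi_pos])
  have hd : ∀ x, HasDerivAt (fun t => sin t ^ 3 * f' t)
      (-(N ^ 2 - 9 / 4) * (sin x ^ 3 * f x)) x := fun x => by
    refine (((Real.hasDerivAt_sin x).pow 3).mul (h.deriv2 x)).congr_deriv ?_
    simp only [Pi.pow_apply]
    push_cast
    linear_combination sin x * h.eqn x
  have := (convex_Icc 0 t).norm_image_sub_le_of_norm_hasDerivWithin_le
    (fun x _ => (hd x).hasDerivWithinAt) (C := (N ^ 2 - 9 / 4) * (sin t ^ 3 * |f 0|))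
    (fun x hx => ?_) (x := 0) (y := t) ⟨le_rfl, hpos.le⟩ ⟨hpos.le, le_rfl⟩
  · simp only [h0, mul_zero, sub_zero, norm_mul, Real.norm_eq_abs, abs_pow, abs_of_pos hs,
      abs_of_pos hpos] at this
    have h3 : sin t ^ 3 * |f' t| ≤ sin t ^ 3 * ((N ^ 2 - 9 / 4) * |f 0| * t) := by linarith
    exact le_of_mul_le_mul_left h3 (by positivity)
  · have hx2 : x ≤ π / 2 := hx.2.trans ht.2
    have h1 : 0 ≤ sin x := Real.sin_nonneg_of_nonneg_of_le_pi hx.1 (by linarith [Real.pi_pos])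
    have h2 : sin x ≤ sin t := Real.sin_le_sin_of_le_of_le_pi_div_two
      (by linarith [hx.1, Real.pi_pos]) ht.2 hx.2
    have h3 : |f x| ≤ |f 0| := sq_le_sq.1 (h.sq_le_sq_pole hN h0 ⟨hx.1, hx2⟩)
    rw [norm_mul, norm_mul, norm_neg, Real.norm_eq_abs, Real.norm_eq_abs, Real.norm_eq_abs,
      abs_of_pos hL, abs_of_nonneg (pow_nonneg h1 3)]
    gcongr

theorem sq_pole_le (h : ZonalODE N f f' f'') (hN : 5 / 2 ≤ N) (h0 : f' 0 = 0) :
    f 0 ^ 2 ≤ 6000 * N ^ 3 * ∫ t in (0)..π, sin t ^ 3 * f t ^ 2 := by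
  have hN0 : 0 < N := by linarith
  -- With `N t = 19/20`, the point is far enough from the pole for `N sin t ≥ 9/10`, yet `(N t)² =
  -- 361/400 < 1`, so `f` keeps at least `39/400` of its polar size.
  set t := 19 / 20 / N with htdef
  have htN : N * t = 19 / 20 := by rw [htdef]; field_simp
  have ht0 : 0 < t := by positivity
  have ht1 : t ≤ 19 / 50 := by
    rw [htdef, div_le_iff₀ hN0]; linarith
  have hpi := Real.pi_gt_three
  have hs : 9 / 10 ≤ N * sin t := by
    have h1 := (Real.sin_gt_sub_cube ht0).le
    have h2 : N * (t - t ^ 3 / 6) ≤ N * sin t := by gcongr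
    have h3 : N * (t - t ^ 3 / 6) = N * t * (1 - t ^ 2 / 6) := by ring
    rw [h3, htN] at h2
    nlinarith
  have hb := h.sin_pow_mul_sq_le_of_le hN ⟨ht0.le, by linarith⟩ hs
  set A := ∫ t in (0)..π, sin t ^ 3 * f t ^ 2
  have hdiff := (convex_Icc 0 t).norm_image_sub_le_of_norm_hasDerivWithin_le
    (fun x _ => (h.deriv1 x).hasDerivWithinAt) (C := (N ^ 2 - 9 / 4) * |f 0| * t)
    (fun x hx => (h.abs_deriv_le hN h0 ⟨hx.1, by linarith [hx.2]⟩).trans (by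
      have : 0 < N ^ 2 - 9 / 4 := by nlinarith
      have := hx.2
      gcongr)) (x := 0) (y := t) ⟨le_rfl, ht0.le⟩ ⟨ht0.le, le_rfl⟩
  simp only [sub_zero, Real.norm_eq_abs, abs_of_pos ht0] at hdiff
  have h1 : (N ^ 2 - 9 / 4) * |f 0| * t * t ≤ 361 / 400 * |f 0| := by
    have : (N ^ 2 - 9 / 4) * t * t ≤ 361 / 400 := by nlinarith [mul_pos ht0 ht0]
    nlinarith [abs_nonneg (f 0)]
  have h2 : 39 / 400 * |f 0| ≤ |f t| := by
    have := abs_sub_abs_le_abs_sub (f 0) (f t)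
    rw [abs_sub_comm] at this
    linarith
  have h3 : (39 / 400) ^ 2 * f 0 ^ 2 ≤ f t ^ 2 := by
    rw [← sq_abs (f 0), ← sq_abs (f t), ← mul_pow]
    gcongr
  have h4 : (9 / 10) ^ 3 * f t ^ 2 ≤ N ^ 3 * (37 * A) := by
    calc (9 / 10) ^ 3 * f t ^ 2 ≤ (N * sin t) ^ 3 * f t ^ 2 := by gcongr
      _ = N ^ 3 * (sin t ^ 3 * f t ^ 2) := by ring
      _ ≤ N ^ 3 * (37 * A) := by gcongr
  have : 0 ≤ N ^ 3 * A := by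
    have := mul_nonneg (by norm_num : (0:ℝ) ≤ (9 / 10) ^ 3) (sq_nonneg (f t))
    linarith
  linarith

theorem sq_le (h : ZonalODE N f f' f'') (hN : 5 / 2 ≤ N) (h0 : f' 0 = 0) (hpi : f' π = 0)
    {t : ℝ} (ht : t ∈ Icc 0 π) :
    f t ^ 2 ≤ 6000 * N ^ 3 * ∫ t in (0)..π, sin t ^ 3 * f t ^ 2 := by
  rcases le_total t (π / 2) with hle | hle
  · exact (h.sq_le_sq_pole hN h0 ⟨ht.1, hle⟩).trans (h.sq_pole_le hN h0)
  · have h1 := (h.reflect.sq_le_sq_pole hN (by simp [hpi]) (t := π - t)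
      ⟨by linarith [ht.2], by linarith⟩).trans (h.reflect.sq_pole_le hN (by simp [hpi]))
    have h2 := intervalIntegral.integral_comp_sub_left (a := 0) (b := π)
      (fun t => sin t ^ 3 * f t ^ 2) π
    simp only [Real.sin_pi_sub, sub_zero, sub_self] at h2
    rwa [h2, sub_sub_cancel] at h1

theorem sin_pow_mul_sq_le (h : ZonalODE N f f' f'') (hN : 5 / 2 ≤ N) (h0 : f' 0 = 0)
    (hpi : f' π = 0) {t : ℝ} (ht : t ∈ Icc 0 π) :
    sin t ^ 3 * f t ^ 2 ≤ 6000 * ∫ t in (0)..π, sin t ^ 3 * f t ^ 2 := by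
  have hA : 0 ≤ ∫ t in (0)..π, sin t ^ 3 * f t ^ 2 :=
    intervalIntegral.integral_nonneg Real.pi_pos.le fun t ht =>
      mul_nonneg (pow_nonneg (Real.sin_nonneg_of_mem_Icc ht) 3) (sq_nonneg _)
  rcases le_total (9 / 10) (N * sin t) with hs | hs
  · exact (h.sin_pow_mul_sq_le_of_le hN ht hs).trans (by linarith)
  · have hsin := Real.sin_nonneg_of_mem_Icc ht
    have hN0 : 0 < N := by linarith
    have h1 := h.sq_le hN h0 hpi ht
    set A := ∫ t in (0)..π, sin t ^ 3 * f t ^ 2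
    calc sin t ^ 3 * f t ^ 2 ≤ sin t ^ 3 * (6000 * N ^ 3 * A) := by gcongr
      _ = (N * sin t) ^ 3 * (6000 * A) := by ring
      _ ≤ 1 ^ 3 * (6000 * A) := by gcongr; linarith
      _ = 6000 * A := by ring

end ZonalODE

end

/-! ### Integration of zonal functions in polar coordinates -/

section

open Set
open scoped ENNReal Real

theorem lintegral_eq_lintegral_toSphere {E : Type*} [NormedAddCommGroup E] [NormedSpace ℝ E]
    [MeasurableSpace E] [BorelSpace E] [FiniteDimensional ℝ E] [Nontrivial E] (μ : Measure E)
    [μ.IsAddHaarMeasure] {h : E → ℝ≥0∞} (hh : Measurable h) :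
    ∫⁻ x, h x ∂μ = ∫⁻ w : sphere (0 : E) 1, (∫⁻ r in Ioi (0 : ℝ),
      ENNReal.ofReal (r ^ (Module.finrank ℝ E - 1)) * h (r • (w : E))) ∂μ.toSphere := by
  have hm : Measurable fun p : sphere (0 : E) 1 × ℝ => h (p.2 • (p.1 : E)) :=
    hh.comp (by fun_prop)
  have hm' : Measurable fun p : sphere (0 : E) 1 × Ioi (0 : ℝ) => h ((p.2 : ℝ) • (p.1 : E)) :=
    hh.comp (by fun_prop)
  calc
    ∫⁻ x, h x ∂μ = ∫⁻ x in ({0}ᶜ : Set E), h x ∂μ := by rw [restrict_compl_singleton]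
    _ = ∫⁻ x : ({0}ᶜ : Set E), h x ∂(μ.comap (↑)) :=
      (lintegral_subtype_comap (measurableSet_singleton _).compl _).symm
    _ = ∫⁻ p : sphere (0 : E) 1 × Ioi (0 : ℝ), h ((p.2 : ℝ) • (p.1 : E))
        ∂μ.toSphere.prod (.volumeIoiPow (Module.finrank ℝ E - 1)) := by
      rw [← μ.measurePreserving_homeomorphUnitSphereProd.lintegral_comp hm']
      refine lintegral_congr fun x => ?_
      have : ‖(x : E)‖ ≠ 0 := norm_ne_zero_iff.2 x.2
      simp [smul_smul, this]
    _ = ∫⁻ w : sphere (0 : E) 1, ∫⁻ r : Ioi (0 : ℝ), h ((r : ℝ) • (w : E))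
        ∂(.volumeIoiPow (Module.finrank ℝ E - 1)) ∂μ.toSphere := lintegral_prod _ hm'.aemeasurable
    _ = _ := by
      refine lintegral_congr fun w => ?_
      have hmw : Measurable fun r : Ioi (0 : ℝ) => h ((r : ℝ) • (w : E)) := hh.comp (by fun_prop)
      rw [Measure.volumeIoiPow, lintegral_withDensity_eq_lintegral_mul _ (by fun_prop) hmw]
      exact lintegral_subtype_comap measurableSet_Ioi
        fun r => ENNReal.ofReal (r ^ (Module.finrank ℝ E - 1)) * h (r • (w : E))

theorem lintegral_comp_norm {E : Type*} [NormedAddCommGroup E] [NormedSpace ℝ E]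
    [MeasurableSpace E] [BorelSpace E] [FiniteDimensional ℝ E] [Nontrivial E] (μ : Measure E)
    [μ.IsAddHaarMeasure] {h : ℝ → ℝ≥0∞} (hh : Measurable h) :
    ∫⁻ x, h ‖x‖ ∂μ = μ.toSphere univ * ∫⁻ r in Ioi (0 : ℝ),
      ENNReal.ofReal (r ^ (Module.finrank ℝ E - 1)) * h r := by
  rw [lintegral_eq_lintegral_toSphere μ (h := fun x => h ‖x‖) (hh.comp measurable_norm), mul_comm, ← lintegral_const]
  refine lintegral_congr fun w => setLIntegral_congr_fun measurableSet_Ioi fun r hr => ?_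
  simp [norm_smul, abs_of_pos (mem_Ioi.1 hr)]

/-- A unit vector is the first vector of some orthonormal basis. -/
theorem exists_orthonormalBasis_zero_eq {d : ℕ} (e : UnitSphere d) :
    ∃ b : OrthonormalBasis (Fin (d + 1)) ℝ (EuclideanSpace ℝ (Fin (d + 1))), b 0 = e := by
  obtain ⟨b, hb⟩ := Orthonormal.exists_orthonormalBasis_extension_of_card_eq (𝕜 := ℝ)
    (E := EuclideanSpace ℝ (Fin (d + 1))) (ι := Fin (d + 1)) (by simp)
    (v := fun _ => (e : EuclideanSpace ℝ (Fin (d + 1)))) (s := {0}) (by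
      rw [orthonormal_iff_ite]
      rintro ⟨i, rfl⟩ ⟨j, rfl⟩
      simp)
  exact ⟨b, hb 0 rfl⟩

theorem lintegral_comp_inner_norm {d : ℕ} (e : UnitSphere d) {H : ℝ × ℝ → ℝ≥0∞}
    (hH : Measurable H) :
    ∫⁻ x : EuclideanSpace ℝ (Fin (d + 1)), H (inner ℝ (e : EuclideanSpace ℝ (Fin (d + 1))) x, ‖x‖)
      = ∫⁻ t : ℝ, ∫⁻ y : EuclideanSpace ℝ (Fin d), H (t, √(t ^ 2 + ‖y‖ ^ 2)) := by
  obtain ⟨b, hb⟩ := exists_orthonormalBasis_zero_eq e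
  have e1 : ∀ x, H (inner ℝ (e : EuclideanSpace ℝ (Fin (d + 1))) x, ‖x‖)
      = (fun z : EuclideanSpace ℝ (Fin (d + 1)) => H (z 0, ‖z‖)) (b.measurableEquiv x) := by
    intro x
    simp [OrthonormalBasis.measurableEquiv, b.repr_apply_apply, hb]
  simp_rw [e1]
  rw [b.measurePreserving_measurableEquiv.lintegral_comp (f := fun z => H (z 0, ‖z‖))
      (hH.comp (by fun_prop)),
    ← (PiLp.volume_preserving_toLp (Fin (d + 1))).lintegral_comp (f := fun z => H (z 0, ‖z‖))
      (hH.comp (by fun_prop)),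
    ← (volume_preserving_piFinSuccAbove (fun _ : Fin (d + 1) => ℝ) 0).symm.lintegral_comp
      (f := fun z : Fin (d + 1) → ℝ => H ((WithLp.toLp 2 z) 0, ‖WithLp.toLp 2 z‖))
      (hH.comp (by fun_prop))]
  rw [Measure.volume_eq_prod, lintegral_prod _ (Measurable.aemeasurable (by
    refine hH.comp ?_
    fun_prop))]
  refine lintegral_congr fun t => ?_
  rw [← (PiLp.volume_preserving_toLp (Fin d)).lintegral_comp
    (f := fun y => H (t, √(t ^ 2 + ‖y‖ ^ 2))) (hH.comp (by fun_prop))]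
  refine lintegral_congr fun y => ?_
  simp [EuclideanSpace.norm_eq, Fin.sum_univ_succ, MeasurableEquiv.piFinSuccAbove,
    Real.sq_sqrt (Finset.sum_nonneg fun i _ => sq_nonneg (y i))]


theorem measurable_geodesicDist {d : ℕ} (e : UnitSphere d) : Measurable (geodesicDist e) := by
  have : Continuous fun x : UnitSphere d =>
      Real.arccos (inner ℝ (e : EuclideanSpace ℝ (Fin (d + 1))) x) := by fun_prop
  convert this.measurable using 2 with x
  simp [geodesicDist, InnerProductGeometry.angle]

/-- The upper half-plane in polar coordinates. -/
theorem lintegral_upperHalfPlane_eq_polar {g : ℝ × ℝ → ℝ≥0∞} (hg : Measurable g) :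
    ∫⁻ t : ℝ, ∫⁻ r in Ioi (0 : ℝ), g (t, r) =
      ∫⁻ r in Ioi (0 : ℝ), ∫⁻ θ in Ioo 0 π,
        ENNReal.ofReal r * g (r * Real.cos θ, r * Real.sin θ) := by
  have hS : MeasurableSet {p : ℝ × ℝ | 0 < p.2} := measurableSet_lt measurable_const measurable_snd
  have h1 : ∫⁻ t : ℝ, ∫⁻ r in Ioi (0 : ℝ), g (t, r)
      = ∫⁻ p : ℝ × ℝ, {p : ℝ × ℝ | 0 < p.2}.indicator g p := by
    rw [Measure.volume_eq_prod, lintegral_prod _ (hg.indicator hS).aemeasurable]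
    refine lintegral_congr fun t => ?_
    rw [← lintegral_indicator measurableSet_Ioi]
    rfl
  have hm : Measurable fun p : ℝ × ℝ => ENNReal.ofReal p.1 •
      {p : ℝ × ℝ | 0 < p.2}.indicator g (polarCoord.symm p) := by
    have := (hg.indicator hS).comp continuous_polarCoord_symm.measurable
    simp only [smul_eq_mul]
    exact (by fun_prop : Measurable fun p : ℝ × ℝ => ENNReal.ofReal p.1).mul this
  rw [h1, ← lintegral_comp_polarCoord_symm, polarCoord_target, Measure.volume_eq_prod,
    setLIntegral_prod _ hm.aemeasurable]
  refine setLIntegral_congr_fun measurableSet_Ioi fun r hr => ?_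
  simp only [polarCoord_symm_apply, smul_eq_mul]
  rw [← lintegral_indicator measurableSet_Ioo, ← lintegral_indicator measurableSet_Ioo]
  refine lintegral_congr fun θ => ?_
  have hr : 0 < r := hr
  by_cases h0 : θ ∈ Ioo 0 π
  · have h2 : θ ∈ Ioo (-π) π := ⟨by linarith [h0.1, Real.pi_pos], h0.2⟩
    have h3 := Real.sin_pos_of_mem_Ioo h0
    have h4 : (r * Real.cos θ, r * Real.sin θ) ∈ {p : ℝ × ℝ | 0 < p.2} := mul_pos hr h3
    rw [indicator_of_mem h0, indicator_of_mem h2, indicator_of_mem h4]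
  · rw [indicator_of_notMem h0]
    by_cases h2 : θ ∈ Ioo (-π) π
    · rw [indicator_of_mem h2]
      have h3 : Real.sin θ ≤ 0 := Real.sin_nonpos_of_nonpos_of_neg_pi_le
        (by by_contra! h; exact h0 ⟨h, h2.2⟩) h2.1.le
      have h4 : (r * Real.cos θ, r * Real.sin θ) ∉ {p : ℝ × ℝ | 0 < p.2} :=
        not_lt.2 (mul_nonpos_of_nonneg_of_nonpos hr.le h3)
      rw [indicator_of_notMem h4, mul_zero]
    · rw [indicator_of_notMem h2]

/-- Integration of a zonal function over `𝕊^d`, in terms of the geodesic distance to the pole. -/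
theorem lintegral_comp_geodesicDist {d : ℕ} (hd : 1 ≤ d) (e : UnitSphere d) {G : ℝ → ℝ≥0∞}
    (hG : Measurable G) :
    ∫⁻ x, G (geodesicDist e x) ∂surfaceMeasure d =
      (volume : Measure (EuclideanSpace ℝ (Fin d))).toSphere univ *
        ∫⁻ θ in Ioo 0 π, ENNReal.ofReal (Real.sin θ ^ (d - 1)) * G θ := by
  have : Nonempty (Fin d) := ⟨⟨0, hd⟩⟩
  have : Nontrivial (EuclideanSpace ℝ (Fin d)) := inferInstance
  set σ := (volume : Measure (EuclideanSpace ℝ (Fin d))).toSphere univ with hσ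
  -- The function of the angle is integrated over the unit ball of `ℝ^(d+1)` in two ways: by
  -- spheres, and by cylindrical coordinates around the axis `e`. Both produce the radial factor
  -- `J`, which is positive and finite and cancels.
  set B : ℝ → ℝ≥0∞ := (Iio 1).indicator 1 with hB
  have mB : Measurable B := measurable_one.indicator measurableSet_Iio
  set J := ∫⁻ r in Ioi (0 : ℝ), ENNReal.ofReal (r ^ d) * B r with hJ
  have hJval : J = ∫⁻ r in Ioo (0 : ℝ) 1, ENNReal.ofReal (r ^ d) := by
    rw [hJ, ← lintegral_indicator measurableSet_Ioi, ← lintegral_indicator measurableSet_Ioo]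
    refine lintegral_congr fun r => ?_
    by_cases h0 : 0 < r <;> by_cases h1 : r < 1 <;> simp [hB, h0, h1, indicator]
  have hJ0 : J ≠ 0 := by
    rw [hJval]
    refine ((setLIntegral_pos_iff (by fun_prop)).2 ?_).ne'
    rw [inter_eq_right.2 fun r hr => ?_]
    · simp
    · simpa using pow_pos hr.1 d
  have hJt : J ≠ ∞ := by
    rw [hJval]
    refine (setLIntegral_lt_top_of_le_nnreal (by simp) ⟨1, fun r hr => ?_⟩).ne
    simpa using pow_le_one₀ hr.1.le hr.2.le
  set H : ℝ × ℝ → ℝ≥0∞ := fun p => B p.2 * G (Real.arccos (p.1 / p.2)) with hH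
  have mH : Measurable H :=
    (mB.comp measurable_snd).mul (hG.comp (Real.continuous_arccos.measurable.comp (by fun_prop)))
  have h1 := lintegral_comp_inner_norm e mH
  have h2 : ∫⁻ x : EuclideanSpace ℝ (Fin (d + 1)),
      H (inner ℝ (e : EuclideanSpace ℝ (Fin (d + 1))) x, ‖x‖)
      = (∫⁻ x, G (geodesicDist e x) ∂surfaceMeasure d) * J := by
    rw [lintegral_eq_lintegral_toSphere volume
      (h := fun x => H (inner ℝ (e : EuclideanSpace ℝ (Fin (d + 1))) x, ‖x‖))
      (mH.comp (by fun_prop)), ← lintegral_mul_const (f := fun x => G (geodesicDist e x)) _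
        (hG.comp (measurable_geodesicDist e))]
    refine lintegral_congr fun w => ?_
    rw [hJ, ← lintegral_const_mul _ (by fun_prop)]
    refine setLIntegral_congr_fun measurableSet_Ioi fun r hr => ?_
    have hr : 0 < r := hr
    have : inner ℝ (e : EuclideanSpace ℝ (Fin (d + 1))) (r • (w : EuclideanSpace ℝ _)) / r
      = inner ℝ (e : EuclideanSpace ℝ (Fin (d + 1))) (w : EuclideanSpace ℝ (Fin (d + 1))) := by
      rw [real_inner_smul_right]; field_simp
    simp [hH, norm_smul, abs_of_pos hr, this, geodesicDist, InnerProductGeometry.angle]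
    ring
  have h3 : ∫⁻ t : ℝ, ∫⁻ y : EuclideanSpace ℝ (Fin d), H (t, √(t ^ 2 + ‖y‖ ^ 2))
      = σ * (∫⁻ θ in Ioo 0 π, ENNReal.ofReal (Real.sin θ ^ (d - 1)) * G θ) * J := by
    have mg : Measurable fun p : ℝ × ℝ =>
        ENNReal.ofReal (p.2 ^ (d - 1)) * H (p.1, √(p.1 ^ 2 + p.2 ^ 2)) :=
      (by fun_prop : Measurable fun p : ℝ × ℝ => ENNReal.ofReal (p.2 ^ (d - 1))).mul
        (mH.comp (by fun_prop))
    have e1 : ∀ t : ℝ, ∫⁻ y : EuclideanSpace ℝ (Fin d), H (t, √(t ^ 2 + ‖y‖ ^ 2))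
        = σ * ∫⁻ r in Ioi (0 : ℝ), ENNReal.ofReal (r ^ (d - 1)) * H (t, √(t ^ 2 + r ^ 2)) := by
      intro t
      rw [lintegral_comp_norm volume (h := fun r => H (t, √(t ^ 2 + r ^ 2)))
        (mH.comp (by fun_prop))]
      simp [hσ]
    simp_rw [e1]
    rw [lintegral_const_mul _ (Measurable.lintegral_prod_right mg),
      lintegral_upperHalfPlane_eq_polar mg, mul_assoc]
    congr 1
    rw [mul_comm _ J, hJ, ← lintegral_mul_const _ (by fun_prop)]
    refine setLIntegral_congr_fun measurableSet_Ioi fun r hr => ?_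
    have hr : 0 < r := hr
    rw [← lintegral_const_mul _ (by fun_prop)]
    refine setLIntegral_congr_fun measurableSet_Ioo fun θ hθ => ?_
    have hs := Real.sin_pos_of_mem_Ioo hθ
    have h4 : √((r * Real.cos θ) ^ 2 + (r * Real.sin θ) ^ 2) = r := by
      rw [mul_pow, mul_pow, ← mul_add, Real.cos_sq_add_sin_sq, mul_one, Real.sqrt_sq hr.le]
    have h5 : r * Real.cos θ / r = Real.cos θ := by field_simp
    have h6 : r ^ d = r * r ^ (d - 1) := by rw [← pow_succ', Nat.sub_add_cancel hd]
    simp only [hH, h4, h5, Real.arccos_cos hθ.1.le hθ.2.le]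
    rw [mul_pow, ENNReal.ofReal_mul (by positivity), h6, ENNReal.ofReal_mul hr.le]
    ring
  rw [h2, h3] at h1
  exact (ENNReal.mul_left_inj hJ0 hJt).1 h1

end

/-! ### The differential equation of a zonal harmonic -/

section

open Set
open scoped Real

section Harmonic

open MvPolynomial

variable {d : ℕ}

/-- The value of a complex polynomial at a real point. -/
noncomputable def realEval (P : MvPolynomial (Fin (d + 1)) ℂ)
    (x : EuclideanSpace ℝ (Fin (d + 1))) : ℂ :=
  eval (fun i => ((x i : ℝ) : ℂ)) P

/-- The derivative of a polynomial in a constant direction. -/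
noncomputable def dirDeriv (u : EuclideanSpace ℝ (Fin (d + 1))) :
    Derivation ℂ (MvPolynomial (Fin (d + 1)) ℂ) (MvPolynomial (Fin (d + 1)) ℂ) :=
  mkDerivation ℂ fun i => C ((u i : ℝ) : ℂ)

theorem dirDeriv_apply (u : EuclideanSpace ℝ (Fin (d + 1))) (P : MvPolynomial (Fin (d + 1)) ℂ) :
    dirDeriv u P = ∑ i, C ((u i : ℝ) : ℂ) * pderiv i P := by
  induction P using MvPolynomial.induction_on with
  | C a => simp
  | add P Q hP hQ => simp only [map_add, hP, hQ, mul_add, Finset.sum_add_distrib]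
  | mul_X P j hP =>
    have h1 : dirDeriv u (X j) = C ((u j : ℝ) : ℂ) := mkDerivation_X _ _ _
    simp only [Derivation.leibniz, smul_eq_mul, hP, mul_add, Finset.sum_add_distrib, pderiv_X, h1,
      Finset.mul_sum]
    congr 1
    · rw [Finset.sum_eq_single j] <;> simp +contextual [eq_comm, mul_comm]
    · exact Finset.sum_congr rfl fun i _ => by ring

theorem isHomogeneous_dirDeriv (u : EuclideanSpace ℝ (Fin (d + 1)))
    {P : MvPolynomial (Fin (d + 1)) ℂ} {p : ℕ} (hP : P.IsHomogeneous p) :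
    (dirDeriv u P).IsHomogeneous (p - 1) := by
  rw [dirDeriv_apply]
  refine IsHomogeneous.sum _ _ _ fun i _ => ?_
  simpa using (isHomogeneous_C (Fin (d + 1)) ((u i : ℝ) : ℂ)).mul (hP.pderiv (i := i))

theorem sum_dirDeriv_dirDeriv
    (b : OrthonormalBasis (Fin (d + 1)) ℝ (EuclideanSpace ℝ (Fin (d + 1))))
    (P : MvPolynomial (Fin (d + 1)) ℂ) :
    ∑ k, dirDeriv (b k) (dirDeriv (b k) P) = polyLaplacian P := by
  have key : ∀ i j : Fin (d + 1), ∑ k, b k i * b k j = if i = j then 1 else 0 := by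
    intro i j
    have := b.sum_inner_mul_inner (EuclideanSpace.single i (1 : ℝ)) (EuclideanSpace.single j 1)
    simpa [EuclideanSpace.inner_single_left, EuclideanSpace.inner_single_right, Pi.single_apply,
      eq_comm] using this
  simp only [dirDeriv_apply, map_sum, Derivation.leibniz, pderiv_C, add_zero, smul_eq_mul,
    Finset.mul_sum, polyLaplacian, mul_zero, Finset.sum_const_zero]
  rw [Finset.sum_comm]
  refine Finset.sum_congr rfl fun i _ => ?_
  rw [Finset.sum_comm]
  have : ∀ j, ∑ k, C ((b k i : ℝ) : ℂ) * (C ((b k j : ℝ) : ℂ) * pderiv j (pderiv i P))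
      = if i = j then pderiv j (pderiv i P) else 0 := by
    intro j
    simp_rw [← mul_assoc, ← C_mul, ← Finset.sum_mul, ← map_sum, ← Complex.ofReal_mul,
      ← Complex.ofReal_sum, key]
    split_ifs <;> simp
  simp [this]

theorem hasDerivAt_realEval (P : MvPolynomial (Fin (d + 1)) ℂ)
    (w u v : EuclideanSpace ℝ (Fin (d + 1))) {α β : ℝ → ℝ} {α' β' t : ℝ}
    (hα : HasDerivAt α α' t) (hβ : HasDerivAt β β' t) :
    HasDerivAt (fun t => realEval P (w + α t • u + β t • v))
      (α' * realEval (dirDeriv u P) (w + α t • u + β t • v)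
        + β' * realEval (dirDeriv v P) (w + α t • u + β t • v)) t := by
  induction P using MvPolynomial.induction_on with
  | C a => simpa [realEval, dirDeriv] using hasDerivAt_const t a
  | add P Q hP hQ =>
    have := hP.add hQ
    simp only [realEval, map_add] at this ⊢
    exact this.congr_deriv (by ring)
  | mul_X P i hP =>
    have h1 : HasDerivAt (fun t => (((w + α t • u + β t • v) i : ℝ) : ℂ))
        (((α' * u i + β' * v i : ℝ)) : ℂ) t := by
      refine HasDerivAt.ofReal_comp ?_
      exact ((hα.mul_const (u i)).const_add (w i)).add (hβ.mul_const (v i))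
    have := hP.mul h1
    simp only [realEval, map_mul, eval_X, dirDeriv, Derivation.leibniz, mkDerivation_X, map_add,
      smul_eq_mul, eval_C] at this ⊢
    refine this.congr_deriv ?_
    push_cast
    ring

theorem euler_realEval {P : MvPolynomial (Fin (d + 1)) ℂ} {p : ℕ} (hP : P.IsHomogeneous p)
    (u v : EuclideanSpace ℝ (Fin (d + 1))) (a b : ℝ) :
    a * realEval (dirDeriv u P) (a • u + b • v) + b * realEval (dirDeriv v P) (a • u + b • v)
      = p * realEval P (a • u + b • v) := by
  have h := congrArg (fun Q => realEval Q (a • u + b • v)) hP.sum_X_mul_pderiv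
  simp only [realEval, map_sum, map_mul, eval_X, nsmul_eq_mul, map_natCast, dirDeriv_apply,
    eval_C] at h ⊢
  rw [← h, Finset.mul_sum, Finset.mul_sum, ← Finset.sum_add_distrib]
  refine Finset.sum_congr rfl fun i _ => ?_
  simp
  ring

theorem HasDerivAt.eq_zero_of_reflect {F : ℝ → ℂ} {a : ℝ} {c : ℂ} (h : HasDerivAt F c a)
    (hF : ∀ t, F (2 * a - t) = F t) : c = 0 := by
  have ha : 2 * a - a = a := by ring
  have h1 : HasDerivAt F c (2 * a - a) := by rwa [ha]
  have h2 := h1.scomp a ((hasDerivAt_id a).const_sub (2 * a))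
  have h3 : F ∘ (fun t => 2 * a - t) = F := funext hF
  have h4 : HasDerivAt F (-c) a := by simpa [h3] using h2
  exact self_eq_neg.1 (h.unique h4)

/-- Along a meridian, a zonal spherical harmonic of `𝕊⁴` solves an ordinary differential
equation. -/
theorem exists_meridian_of_isZonal {e : UnitSphere 4} {p : ℕ} (hp : 1 ≤ p) {Z : UnitSphere 4 → ℂ}
    (hZ : IsSphericalHarmonic p Z) (hz : IsZonal e Z) :
    ∃ f f' f'' : ℝ → ℂ, (∀ t, HasDerivAt f (f' t) t) ∧ (∀ t, HasDerivAt f' (f'' t) t) ∧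
      f' 0 = 0 ∧ f' π = 0 ∧
      (∀ t, (Real.sin t : ℂ) ^ 2 * f'' t + 3 * (Real.sin t * Real.cos t) * f' t
        + ((p + 3 / 2 : ℂ) ^ 2 - 9 / 4) * Real.sin t ^ 2 * f t = 0) ∧
      ∀ x, Z x = f (geodesicDist e x) := by
  obtain ⟨P, hP, hharm, hPZ⟩ := hZ
  obtain ⟨g, hg⟩ := hz
  obtain ⟨b, hb⟩ := exists_orthonormalBasis_zero_eq e
  have hval : ∀ x : EuclideanSpace ℝ (Fin (4 + 1)), ‖x‖ = 1 →
      realEval P x = g (Real.arccos (inner ℝ (b 0) x)) := by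
    intro x hx
    have h1 := hPZ ⟨x, by simpa using hx⟩
    rw [hg] at h1
    simpa [realEval, geodesicDist, InnerProductGeometry.angle, hx, hb] using h1.symm
  have hin : ∀ i j, inner ℝ (b i) (b j) = if i = j then (1 : ℝ) else 0 :=
    orthonormal_iff_ite.1 b.orthonormal
  -- meridian and parallels through the plane of `b 1` and `b i`
  have hcurve : ∀ (i : Fin (4 + 1)), i ≠ 0 → i ≠ 1 → ∀ t s : ℝ,
      realEval P (Real.cos t • b 0 + (Real.sin t * Real.cos s) • b 1
        + (Real.sin t * Real.sin s) • b i) = g (Real.arccos (Real.cos t)) := by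
    intro i h0 h1 t s
    have hn : ‖Real.cos t • b 0 + (Real.sin t * Real.cos s) • b 1
        + (Real.sin t * Real.sin s) • b i‖ ^ 2 = 1 := by
      rw [← real_inner_self_eq_norm_sq]
      simp only [inner_add_right, inner_add_left, real_inner_smul_right, real_inner_smul_left, hin,
        h0, h1, h0.symm, h1.symm, if_true, if_false, Fin.isValue, one_ne_zero, zero_ne_one]
      linear_combination Real.sin_sq_add_cos_sq t + Real.sin t ^ 2 * Real.sin_sq_add_cos_sq s
    rw [hval _ ((pow_eq_one_iff_of_nonneg (norm_nonneg _) two_ne_zero).1 hn)]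
    simp [inner_add_right, real_inner_smul_right, hin, h0.symm]
  set γ : ℝ → EuclideanSpace ℝ (Fin (4 + 1)) := fun t => Real.cos t • b 0 + Real.sin t • b 1 with hγ
  have hf : ∀ t, realEval P (γ t) = g (Real.arccos (Real.cos t)) := by
    intro t
    simpa [hγ] using hcurve 2 (by decide) (by decide) t 0
  have hder : ∀ (Q : MvPolynomial (Fin (4 + 1)) ℂ) t, HasDerivAt (fun t => realEval Q (γ t))
      (-Real.sin t * realEval (dirDeriv (b 0) Q) (γ t)
        + Real.cos t * realEval (dirDeriv (b 1) Q) (γ t)) t := by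
    intro Q t
    simpa [hγ] using hasDerivAt_realEval Q 0 (b 0) (b 1) (Real.hasDerivAt_cos t)
      (Real.hasDerivAt_sin t)
  have hpar : ∀ (i : Fin (4 + 1)), i ≠ 0 → i ≠ 1 → ∀ t,
      (Real.sin t : ℂ) ^ 2 * realEval (dirDeriv (b i) (dirDeriv (b i) P)) (γ t)
        = Real.sin t * realEval (dirDeriv (b 1) P) (γ t) := by
    intro i h0 h1 t
    -- `P` is constant along the parallel traced by `s`. Its first `s`-derivative therefore vanishes
    -- identically, and differentiating that relation at `s = 0` expresses the second transverse
    -- derivative through `∂₁P`.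
    have hQ := fun (Q : MvPolynomial (Fin (4 + 1)) ℂ) (s : ℝ) =>
      hasDerivAt_realEval Q (Real.cos t • b 0) (b 1) (b i)
      ((Real.hasDerivAt_cos s).const_mul (Real.sin t))
      ((Real.hasDerivAt_sin s).const_mul (Real.sin t))
    have e1 := fun s => (hQ P s).unique (by
      simp only [hcurve i h0 h1 t]
      exact hasDerivAt_const s _)
    have e2 := ((((Real.hasDerivAt_sin 0).neg.const_mul (Real.sin t)).ofReal_comp.mul
      (hQ (dirDeriv (b 1) P) 0)).add
      (((Real.hasDerivAt_cos 0).const_mul (Real.sin t)).ofReal_comp.mul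
      (hQ (dirDeriv (b i) P) 0)))
    have e3 := e2.unique ((hasDerivAt_const (0 : ℝ) (0 : ℂ)).congr_of_eventuallyEq
      (Filter.Eventually.of_forall fun s => by simpa using e1 s))
    simp at e3
    simp only [hγ]
    push_cast
    linear_combination e3
  refine ⟨fun t => realEval P (γ t), fun t => -Real.sin t * realEval (dirDeriv (b 0) P) (γ t)
        + Real.cos t * realEval (dirDeriv (b 1) P) (γ t), fun t =>
        (-Real.cos t * realEval (dirDeriv (b 0) P) (γ t) + -Real.sin t *
          (-Real.sin t * realEval (dirDeriv (b 0) (dirDeriv (b 0) P)) (γ t)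
            + Real.cos t * realEval (dirDeriv (b 1) (dirDeriv (b 0) P)) (γ t))) +
        (-Real.sin t * realEval (dirDeriv (b 1) P) (γ t) + Real.cos t *
          (-Real.sin t * realEval (dirDeriv (b 0) (dirDeriv (b 1) P)) (γ t)
            + Real.cos t * realEval (dirDeriv (b 1) (dirDeriv (b 1) P)) (γ t))),
            hder P, fun t => ?_, ?_, ?_, fun t => ?_, fun x => ?_⟩
  · have := ((Real.hasDerivAt_sin t).ofReal_comp.neg.mul (hder (dirDeriv (b 0) P) t)).add
      ((Real.hasDerivAt_cos t).ofReal_comp.mul (hder (dirDeriv (b 1) P) t))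
    refine this.congr_deriv ?_
    push_cast
    rfl
  -- The profile is a function of `cos t`, hence even about `0` and about `π`.
  · exact (hder P 0).eq_zero_of_reflect fun t => by simp [hf]
  · exact (hder P π).eq_zero_of_reflect fun t => by rw [hf, hf, Real.cos_two_pi_sub]
  · have h1 := euler_realEval hP (b 0) (b 1) (Real.cos t) (Real.sin t)
    have h2 := euler_realEval (isHomogeneous_dirDeriv (b 0) hP) (b 0) (b 1) (Real.cos t) (Real.sin t)
    have h3 := euler_realEval (isHomogeneous_dirDeriv (b 1) hP) (b 0) (b 1) (Real.cos t) (Real.sin t)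
    have h4 : realEval (dirDeriv (b 0) (dirDeriv (b 0) P)) (γ t)
        + realEval (dirDeriv (b 1) (dirDeriv (b 1) P)) (γ t)
        + realEval (dirDeriv (b 2) (dirDeriv (b 2) P)) (γ t)
        + realEval (dirDeriv (b 3) (dirDeriv (b 3) P)) (γ t)
        + realEval (dirDeriv (b 4) (dirDeriv (b 4) P)) (γ t) = 0 := by
      have := congrArg (fun Q => realEval Q (γ t)) ((Fin.sum_univ_five fun k : Fin 5 =>
        dirDeriv (b k) (dirDeriv (b k) P)).symm.trans ((sum_dirDeriv_dirDeriv b P).trans hharm))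
      simpa only [realEval, map_add, map_zero] using this
    have h5 := hpar 2 (by decide) (by decide) t
    have h6 := hpar 3 (by decide) (by decide) t
    have h7 := hpar 4 (by decide) (by decide) t
    have h8 : (Real.sin t : ℂ) ^ 2 + (Real.cos t : ℂ) ^ 2 = 1 := by
      exact_mod_cast Real.sin_sq_add_cos_sq t
    rw [Nat.cast_sub hp, Nat.cast_one] at h2 h3
    have hγt : Real.cos t • b 0 + Real.sin t • b 1 = γ t := rfl
    rw [hγt] at h1 h2 h3
    -- The Laplacian in the basis `b` has its three transverse terms replaced via the parallels, and
    -- Euler's identity for `P` and its first derivatives eliminates the radial ones.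
    linear_combination (Real.sin t : ℂ) ^ 2 * (realEval (dirDeriv (b 0) (dirDeriv (b 0) P)) (γ t)
        + realEval (dirDeriv (b 1) (dirDeriv (b 1) P)) (γ t)) * h8
      + (Real.sin t : ℂ) ^ 2 * h4 - h5 - h6 - h7
      - (Real.sin t : ℂ) ^ 2 * (Real.cos t * h2 + Real.sin t * h3)
      - (p + 3) * (Real.sin t : ℂ) ^ 2 * h1
      + 3 * Real.sin t * realEval (dirDeriv (b 1) P) (γ t) * h8
  · change Z x = realEval P (γ (geodesicDist e x))
    rw [hf, hg, geodesicDist, Real.arccos_cos (InnerProductGeometry.angle_nonneg _ _)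
      (InnerProductGeometry.angle_le_pi _ _)]

end Harmonic

end

/-! ### Profile bounds and the trilinear estimate -/

section

open Set
open scoped ENNReal Real

/-- The volume of `𝕊³`. -/
noncomputable def volThreeSphere : ℝ :=
  (volume : Measure (EuclideanSpace ℝ (Fin 4))).toSphere.real univ

theorem volThreeSphere_pos : 0 < volThreeSphere := by
  unfold volThreeSphere
  rw [Measure.toSphere_real_apply_univ]
  have : 0 < volume.real (ball (0 : EuclideanSpace ℝ (Fin 4)) 1) :=
    ENNReal.toReal_pos (measure_ball_pos _ _ one_pos).ne' measure_ball_lt_top.ne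
  simpa using this

theorem ofReal_volThreeSphere : (volume : Measure (EuclideanSpace ℝ (Fin 4))).toSphere univ
    = ENNReal.ofReal volThreeSphere := by
  rw [volThreeSphere, ofReal_measureReal]

theorem setLIntegral_Ioo_ofReal {g : ℝ → ℝ} (hg : ContinuousOn g (Icc 0 π))
    (h0 : ∀ t ∈ Icc 0 π, 0 ≤ g t) :
    ∫⁻ t in Ioo 0 π, ENNReal.ofReal (g t) = ENNReal.ofReal (∫ t in (0)..π, g t) := by
  rw [intervalIntegral.integral_of_le Real.pi_pos.le,
    restrict_Ioo_eq_restrict_Ioc, ofReal_integral_eq_lintegral_ofReal]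
  · exact (hg.integrableOn_Icc).mono_set Ioc_subset_Icc_self
  · exact (ae_restrict_iff' measurableSet_Ioc).2
      (ae_of_all _ fun t ht => h0 t (Ioc_subset_Icc_self ht))

theorem ZonalODE.of_complex {p : ℕ} {f f' f'' : ℝ → ℂ} (L : ℂ →L[ℝ] ℝ)
    (h1 : ∀ t, HasDerivAt f (f' t) t) (h2 : ∀ t, HasDerivAt f' (f'' t) t)
    (h3 : ∀ t, (Real.sin t : ℂ) ^ 2 * f'' t + 3 * (Real.sin t * Real.cos t) * f' t
        + ((p + 3 / 2 : ℂ) ^ 2 - 9 / 4) * Real.sin t ^ 2 * f t = 0) :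
    ZonalODE (p + 3 / 2) (fun t => L (f t)) (fun t => L (f' t)) (fun t => L (f'' t)) where
  deriv1 t := L.hasFDerivAt.comp_hasDerivAt t (h1 t)
  deriv2 t := L.hasFDerivAt.comp_hasDerivAt t (h2 t)
  eqn t := by
    have e : (Real.sin t ^ 2 : ℝ) • f'' t + (3 * (Real.sin t * Real.cos t) : ℝ) • f' t
        + (((p + 3 / 2 : ℝ) ^ 2 - 9 / 4) * Real.sin t ^ 2 : ℝ) • f t = 0 := by
      rw [← h3 t]
      simp only [Complex.real_smul]
      push_cast
      ring
    simpa only [map_add, map_smul, map_zero, smul_eq_mul] using congrArg L e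

/-- The profile of a normalized zonal harmonic is controlled near the poles and away from them. -/
theorem IsNormalizedZonalHarmonic.exists_profile {e : UnitSphere 4} {p : ℕ} (hp : 1 ≤ p)
    {Z : UnitSphere 4 → ℂ} (hZ : IsNormalizedZonalHarmonic e p Z) :
    ∃ f : ℝ → ℂ, Continuous f ∧ (∀ x, Z x = f (geodesicDist e x)) ∧
      (∀ t ∈ Icc 0 π, ‖f t‖ ^ 2 ≤ 6000 / volThreeSphere * (p + 3 / 2 : ℝ) ^ 3) ∧
      ∀ t ∈ Icc 0 π, Real.sin t ^ 3 * ‖f t‖ ^ 2 ≤ 6000 / volThreeSphere := by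
  obtain ⟨f, f', f'', h1, h2, h0, hpi, h3, hf⟩ := exists_meridian_of_isZonal hp hZ.harmonic hZ.zonal
  have hre := ZonalODE.of_complex Complex.reCLM h1 h2 h3
  have him := ZonalODE.of_complex Complex.imCLM h1 h2 h3
  have hc : Continuous f := continuous_iff_continuousAt.2 fun t => (h1 t).continuousAt
  have hN : (5 : ℝ) / 2 ≤ p + 3 / 2 := by
    have : (1 : ℝ) ≤ p := by exact_mod_cast hp
    linarith
  have hnorm : ∀ t, ‖f t‖ ^ 2 = (f t).re ^ 2 + (f t).im ^ 2 := fun t => by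
    rw [Complex.sq_norm, Complex.normSq_apply]; ring
  have hV := volThreeSphere_pos
  have hA : ∫ t in (0)..π, Real.sin t ^ 3 * ‖f t‖ ^ 2 = 1 / volThreeSphere := by
    have hA0 : 0 ≤ ∫ t in (0)..π, Real.sin t ^ 3 * ‖f t‖ ^ 2 :=
      intervalIntegral.integral_nonneg Real.pi_pos.le fun t ht =>
        mul_nonneg (pow_nonneg (Real.sin_nonneg_of_mem_Icc ht) 3) (sq_nonneg _)
    have e1 := hZ.norm_eq_one
    rw [eLpNorm_eq_lintegral_rpow_enorm_toReal two_ne_zero ENNReal.ofNat_ne_top] at e1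
    replace e1 := congrArg (fun x : ℝ≥0∞ => x ^ (2 : ℝ)) e1
    simp only [ENNReal.toReal_ofNat, ← ENNReal.rpow_mul, ENNReal.one_rpow] at e1
    norm_num at e1
    simp only [hf] at e1
    rw [lintegral_comp_geodesicDist (by norm_num) e (G := fun t => ‖f t‖ₑ ^ 2) (by fun_prop),
      ofReal_volThreeSphere, setLIntegral_congr_fun (g := fun t =>
        ENNReal.ofReal (Real.sin t ^ 3 * ‖f t‖ ^ 2)) measurableSet_Ioo (fun t ht => by
          have := Real.sin_pos_of_mem_Ioo ht
          simp only
          rw [ENNReal.ofReal_mul (by positivity), ← ofReal_norm,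
            ENNReal.ofReal_pow (norm_nonneg _)]),
      setLIntegral_Ioo_ofReal (by fun_prop) (fun t ht =>
        mul_nonneg (pow_nonneg (Real.sin_nonneg_of_mem_Icc ht) 3) (sq_nonneg _)),
      ← ENNReal.ofReal_mul hV.le, ENNReal.ofReal_eq_one] at e1
    rw [eq_div_iff hV.ne', mul_comm, e1]
  have hsplit : ∫ t in (0)..π, Real.sin t ^ 3 * ‖f t‖ ^ 2
      = (∫ t in (0)..π, Real.sin t ^ 3 * (Complex.reCLM (f t)) ^ 2)
        + ∫ t in (0)..π, Real.sin t ^ 3 * (Complex.imCLM (f t)) ^ 2 := by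
    -- The real and imaginary parts each solve the real equation; their `L²` masses add up, so their
    -- bounds add with no loss in the constant.
    rw [← intervalIntegral.integral_add (Continuous.intervalIntegrable (by fun_prop) _ _)
      (Continuous.intervalIntegrable (by fun_prop) _ _)]
    simp only [hnorm, mul_add, Complex.reCLM_apply, Complex.imCLM_apply]
  rw [hA] at hsplit
  refine ⟨f, hc, hf, fun t ht => ?_, fun t ht => ?_⟩
  · have b1 := hre.sq_le hN (by simp [h0]) (by simp [hpi]) ht
    have b2 := him.sq_le hN (by simp [h0]) (by simp [hpi]) ht
    rw [hnorm]
    calc _ ≤ 6000 * (p + 3 / 2 : ℝ) ^ 3 * (1 / volThreeSphere) := by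
          rw [hsplit, mul_add]; exact add_le_add b1 b2
      _ = _ := by ring
  · have b1 := hre.sin_pow_mul_sq_le hN (by simp [h0]) (by simp [hpi]) ht
    have b2 := him.sin_pow_mul_sq_le hN (by simp [h0]) (by simp [hpi]) ht
    rw [hnorm, mul_add]
    calc _ ≤ 6000 * (1 / volThreeSphere) := by
          rw [hsplit, mul_add]; exact add_le_add b1 b2
      _ = _ := by ring

theorem integral_rpow_shift_le {N : ℝ} (hN : 0 < N) :
    ∫ t in (0)..π, (N⁻¹ + t) ^ (-(3 / 2) : ℝ) ≤ 2 * √N := by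
  have hN' := inv_pos.2 hN
  have hpi := Real.pi_pos
  rw [intervalIntegral.integral_comp_add_left (fun x => x ^ (-(3 / 2) : ℝ)) N⁻¹,
    integral_rpow (Or.inr ⟨by norm_num, by
      rw [uIcc_of_le (by linarith)]; intro h; linarith [h.1]⟩)]
  have h1 : (N⁻¹ + 0) ^ (-(3 / 2) + 1 : ℝ) = √N := by
    rw [add_zero, Real.inv_rpow hN.le, ← Real.rpow_neg hN.le, Real.sqrt_eq_rpow]; norm_num
  have h2 : 0 ≤ (N⁻¹ + π) ^ (-(3 / 2) + 1 : ℝ) := by positivity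
  rw [h1]
  norm_num at h2 ⊢
  linarith

/-- Since `(x + y)³ ≤ 4 (x³ + y³)`, the two hypotheses merge into one; `sin t ≥ t/2` costs a factor
8, and `6 = √(4 (1 + 8))`. -/
theorem norm_le_rpow_shift {N B a t : ℝ} (hN : 0 < N) (hB : 0 ≤ B) (ht : 0 ≤ t)
    (ht' : t ≤ π / 2) (h1 : a ^ 2 ≤ B * N ^ 3) (h2 : Real.sin t ^ 3 * a ^ 2 ≤ B) :
    a ≤ 6 * √B * (N⁻¹ + t) ^ (-(3 / 2) : ℝ) := by
  have hN' := inv_pos.2 hN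
  have hs : t / 2 ≤ Real.sin t := by
    refine le_trans ?_ (Real.mul_le_sin ht ht')
    have : 1 / 2 ≤ 2 / π := by
      rw [div_le_div_iff₀ two_pos Real.pi_pos]; linarith [Real.pi_le_four]
    nlinarith
  have h3 : t ^ 3 * a ^ 2 ≤ 8 * B := by
    have : (t / 2) ^ 3 * a ^ 2 ≤ Real.sin t ^ 3 * a ^ 2 := by gcongr
    linarith
  have h4 : N⁻¹ ^ 3 * a ^ 2 ≤ B := by
    rw [inv_pow, inv_mul_le_iff₀ (by positivity)]; linarith
  have h5 : (N⁻¹ + t) ^ 3 * a ^ 2 ≤ 36 * B := by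
    have : (N⁻¹ + t) ^ 3 ≤ 4 * (N⁻¹ ^ 3 + t ^ 3) := by
      nlinarith [mul_nonneg (add_nonneg hN'.le ht) (sq_nonneg (N⁻¹ - t))]
    nlinarith [mul_le_mul_of_nonneg_right this (sq_nonneg a)]
  have h6 : 0 < N⁻¹ + t := by positivity
  rw [Real.rpow_neg h6.le, ← div_eq_mul_inv, le_div_iff₀ (by positivity)]
  refine le_of_sq_le_sq ?_ (by positivity)
  rw [mul_pow, mul_pow, Real.sq_sqrt hB, ← Real.rpow_natCast (_ ^ _), ← Real.rpow_mul h6.le]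
  norm_num
  linarith

/-- Asymmetric form: any one of the three degrees may serve on the right, so the minimum follows by
permuting the factors. -/
theorem eLpNorm_mul_mul_le {e : UnitSphere 4} {p q l : ℕ} (hp : 1 ≤ p) (hq : 1 ≤ q) (hl : 1 ≤ l)
    {Zp Zq Zl : UnitSphere 4 → ℂ} (hZp : IsNormalizedZonalHarmonic e p Zp)
    (hZq : IsNormalizedZonalHarmonic e q Zq) (hZl : IsNormalizedZonalHarmonic e l Zl) :
    eLpNorm (fun x => Zp x * Zq x * Zl x) 1 (surfaceMeasure 4) ≤
      ENNReal.ofReal (288000 * √(6000 / volThreeSphere) * √p) := by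
  obtain ⟨f, cf, hf, f1, f2⟩ := hZp.exists_profile hp
  obtain ⟨g, cg, hg, -, g2⟩ := hZq.exists_profile hq
  obtain ⟨h, ch, hh, -, h2⟩ := hZl.exists_profile hl
  have hV := volThreeSphere_pos
  set V := volThreeSphere
  set B := 6000 / V with hBdef
  have hB : 0 < B := by positivity
  set N : ℝ := p + 3 / 2 with hNdef
  have hN : 0 < N := by positivity
  have hN' := inv_pos.2 hN
  set S : ℝ → ℝ := fun t => (N⁻¹ + t) ^ (-(3 / 2) : ℝ) + (N⁻¹ + (π - t)) ^ (-(3 / 2) : ℝ)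
  have hS0 : ∀ t ∈ Icc 0 π, 0 ≤ (N⁻¹ + t) ^ (-(3 / 2) : ℝ) ∧
      0 ≤ (N⁻¹ + (π - t)) ^ (-(3 / 2) : ℝ) := fun t ht =>
    ⟨Real.rpow_nonneg (by linarith [ht.1]) _, Real.rpow_nonneg (by linarith [ht.2]) _⟩
  have hfS : ∀ t ∈ Icc 0 π, ‖f t‖ ≤ 6 * √B * S t := by
    intro t ht
    have hb : 0 ≤ 6 * √B := by positivity
    rcases le_total t (π / 2) with hle | hle
    · refine (norm_le_rpow_shift hN hB.le ht.1 hle (f1 t ht) (f2 t ht)).trans ?_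
      exact mul_le_mul_of_nonneg_left (le_add_of_nonneg_right (hS0 t ht).2) hb
    · refine (norm_le_rpow_shift hN hB.le (t := π - t) (by linarith [ht.2])
        (by linarith) (f1 t ht) (by simpa using f2 t ht)).trans ?_
      exact mul_le_mul_of_nonneg_left (le_add_of_nonneg_left (hS0 t ht).1) hb
  have c1 : ContinuousOn (fun t : ℝ => (N⁻¹ + t) ^ (-(3 / 2) : ℝ)) (Icc 0 π) :=
    ContinuousOn.rpow_const (by fun_prop) fun t ht => Or.inl (by linarith [ht.1])
  have c2 : ContinuousOn (fun t : ℝ => (N⁻¹ + (π - t)) ^ (-(3 / 2) : ℝ)) (Icc 0 π) :=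
    ContinuousOn.rpow_const (by fun_prop) fun t ht => Or.inl (by linarith [ht.2])
  have hSint : ∫ t in (0)..π, S t ≤ 8 * √p := by
    have i1 := integral_rpow_shift_le hN
    have i2 := intervalIntegral.integral_comp_sub_left (a := 0) (b := π)
      (fun t => (N⁻¹ + t) ^ (-(3 / 2) : ℝ)) π
    rw [intervalIntegral.integral_add (c1.intervalIntegrable_of_Icc Real.pi_pos.le)
      (c2.intervalIntegrable_of_Icc Real.pi_pos.le), i2, sub_self, sub_zero]
    -- `p + 3/2 ≤ 4 p` because `p ≥ 1`.
    have : √N ≤ 2 * √p := by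
      rw [Real.sqrt_le_left (by positivity), mul_pow, Real.sq_sqrt (by positivity)]
      have : (1 : ℝ) ≤ p := by exact_mod_cast hp
      linarith
    linarith
  have cS : ContinuousOn S (Icc 0 π) := c1.add c2
  rw [eLpNorm_one_eq_lintegral_enorm]
  simp only [hf, hg, hh]
  rw [lintegral_comp_geodesicDist (by norm_num) e (G := fun t => ‖f t * g t * h t‖ₑ)
    (by fun_prop), ofReal_volThreeSphere]
  calc _ ≤ ENNReal.ofReal V * ∫⁻ t in Ioo 0 π, ENNReal.ofReal (B * (6 * √B * S t)) := by
        refine mul_le_mul_of_nonneg_left ?_ bot_le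
        refine setLIntegral_mono' measurableSet_Ioo fun t ht => ?_
        have ht' := Ioo_subset_Icc_self ht
        have hs := Real.sin_pos_of_mem_Ioo ht
        rw [← ofReal_norm, ← ENNReal.ofReal_mul (by positivity)]
        refine ENNReal.ofReal_le_ofReal ?_
        -- By the arithmetic-geometric mean inequality the whole weight is spent on the other two
        -- factors.
        have a1 : Real.sin t ^ 3 * (‖g t‖ * ‖h t‖) ≤ B := by
          have := g2 t ht'
          have := h2 t ht'
          have : 0 ≤ Real.sin t ^ 3 * (‖g t‖ - ‖h t‖) ^ 2 := by positivity
          linarith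
        calc _ = (Real.sin t ^ 3 * (‖g t‖ * ‖h t‖)) * ‖f t‖ := by
              rw [norm_mul, norm_mul]; ring
          _ ≤ _ := mul_le_mul a1 (hfS t ht') (norm_nonneg _) hB.le
    _ = ENNReal.ofReal (V * (B * (6 * √B * ∫ t in (0)..π, S t))) := by
        rw [setLIntegral_Ioo_ofReal ((cS.const_mul _).const_mul _) fun t ht => ?_,
          ← ENNReal.ofReal_mul hV.le, intervalIntegral.integral_const_mul,
          intervalIntegral.integral_const_mul]
        have := add_nonneg (hS0 t ht).1 (hS0 t ht).2
        positivity
    _ ≤ _ := by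
        refine ENNReal.ofReal_le_ofReal ?_
        calc _ ≤ V * (B * (6 * √B * (8 * √p))) := by gcongr
          _ = V * B * 48 * √B * √p := by ring
          _ = _ := by
            rw [hBdef, mul_div_cancel₀ _ hV.ne']; ring

end

theorem mainTheorem10 :
    ∃ C : ℝ, 0 < C ∧
      ∀ (e : UnitSphere 4) (p q l : ℕ), 1 ≤ p → 1 ≤ q → 1 ≤ l →
        ∀ Zp Zq Zl : UnitSphere 4 → ℂ,
          IsNormalizedZonalHarmonic e p Zp →
          IsNormalizedZonalHarmonic e q Zq →
          IsNormalizedZonalHarmonic e l Zl →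
            eLpNorm (fun x => Zp x * Zq x * Zl x) 1 (surfaceMeasure 4) ≤
              ENNReal.ofReal (C * Real.sqrt ((min p (min q l) : ℕ) : ℝ)) := by
  have hV := volThreeSphere_pos
  refine ⟨288000 * √(6000 / volThreeSphere), by positivity,
    fun e p q l hp hq hl Zp Zq Zl hZp hZq hZl => ?_⟩
  have h1 := eLpNorm_mul_mul_le hp hq hl hZp hZq hZl
  have h2 := eLpNorm_mul_mul_le hq hp hl hZq hZp hZl
  have h3 := eLpNorm_mul_mul_le hl hp hq hZl hZp hZq
  rcases min_choice p (min q l) with h | h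
  · rwa [h]
  · rw [h]
    rcases min_choice q l with h' | h'
    · rw [h']
      convert h2 using 3
      ring
    · rw [h']
      convert h3 using 3
      ring
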